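/- Let $N\ge 1$, $h=1/N$, $\mathbf k=(k_1,k_2,k_3)\in\mathbb R^3$, and let $\|\mathbf k\|$ be the Euclidean norm. Consider Yee's scheme on the unit cube with periodic boundary conditions and $N$ cells per direction: let $D_1, D_0\in\mathbb R^{N\times N}$ be the periodic matrices $(D_1u)_i=(u_i-u_{i-1})/h$ and $(D_0u)_i=(u_i+u_{i-1})/2$ (indices modulo $N$), and put $$\mathcal D_1=I\otimes I\otimes (D_1+\mathrm i k_1D_0),\quad \mathcal D_2=I\otimes (D_1+\mathrm i k_2D_0)\otimes I,\quad \mathcal D_3=(D_1+\mathrm i k_3D_0)\otimes I\otimes I,$$ $$\mathcal A=\begin{pmatrix}0&-\mathcal D_3&\mathcal D_2\\ \mathcal D_3&0&-\mathcal D_1\\ -\mathcal D_2&\mathcal D_1&0\end{pmatrix},\qquad \mathcal B=\begin{pmatrix}\mathcal D_1&\mathcal D_2&\mathcal D_3\end{pmatrix}.$$ Let $\mathcal M\in\mathbb C^{3N^3\times 3N^3}$ be an arbitrary Hermitian positive definite matrix, let $\mathcal H=\ker\mathcal A^\dagger\cap\ker\mathcal B$, and let $\lambda^{\mathcal A}_1\le\lambda^{\mathcal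 A}_2\le\cdots$ be the positive eigenvalues of $\mathcal A\mathcal M\mathcal A^\dagger$, repeated according to multiplicity. Consider the condition $$(\ast)\qquad \max_i|k_i|\le\pi\quad\text{and}\quad h<1/\pi .$$ (1) If $\mathbf k=0$, then $\mathcal H$ is the three-dimensional complex span of the constant fields $o_1,o_2,o_3$, where $o_i$ equals $1$ on the $i$-th block of $N^3$ coordinates and $0$ on the other two blocks. If $\mathbf k\ne0$ and $(\ast)$ holds, then $\mathcal H=\{0\}$. (2) The positive eigenvalues of $\mathcal A\mathcal M\mathcal A^\dagger$, with multiplicity, are exactly those of the constrained problem $\mathcal A\mathcal M\mathcal A^\dagger H=\mu H$, $\mathcal B H=0$; that is, for every $\mu>0$ the multiplicity of $\mu$ as an eigenvalue of $\mathcal A\mathcal M\mathcal A^\dagger$ equals the dimension of the space of solutions $H$ of the constrained problem. Moreover, let $m\ge1$ be at most the number of positive eigenvalues of $\mathcal A\mathcal M\mathcal A^\dagger$, assume $(\ast)$ if $\mathbf k\neq0$, and let $$\gamma=\begin{cases}\max\{1,\lambda^{\mathcal A}_m\},&\mathbf k=0,\\ \max\{1,\lambda^{\mathcal A}_m\}\cdot\max\{1,\|\mathbf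 k\|^{-2}\},&\mathbf k\ne0.\end{cases}$$ Then the $m$ smallest positive eigenvalues of $\mathcal A\mathcal M\mathcal A^\dagger+\gamma\,\mathcal B^\dagger\mathcal B$, repeated according to multiplicity, are $\lambda^{\mathcal A}_1,\dots,\lambda^{\mathcal A}_m$. -/

import Mathlib

open scoped Kronecker ComplexOrder

noncomputable section

/-- The periodic grid of a unit cube with `N` cells per direction; a point is a triple `(l, j, i)`
of coordinates modulo `N`, in the order `(z, y, x)`, the first coordinate varying slowest. -/
abbrev YeeGrid (N : ℕ) : Type := ZMod N × ZMod N × ZMod N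

/-- The degrees of freedom of a discrete vector field: a component and a grid point. The three
blocks `(0, ·)`, `(1, ·)`, `(2, ·)` are the three components of the field. -/
abbrev YeeDof (N : ℕ) : Type := Fin 3 × YeeGrid N

/-- The grid size `h = 1 / N`. -/
def yeeGridSize (N : ℕ) : ℝ := 1 / N

/-- The circulant backward difference matrix: `(1 / h) (u i - u (i - 1))`. -/
def yeeDiff (N : ℕ) : Matrix (ZMod N) (ZMod N) ℂ :=
  ((1 / yeeGridSize N : ℝ) : ℂ) •
    Matrix.of fun i j => (if j = i then 1 else 0) - (if j = i - 1 then 1 else 0)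

/-- The circulant averaging matrix: `(1 / 2) (u i + u (i - 1))`. -/
def yeeAvg (N : ℕ) : Matrix (ZMod N) (ZMod N) ℂ :=
  (1 / 2 : ℂ) • Matrix.of fun i j => (if j = i then 1 else 0) + (if j = i - 1 then 1 else 0)

/-- The action of a one-dimensional matrix `C` along the first, second or third axis:
`I ⊗ I ⊗ C`, `I ⊗ C ⊗ I`, `C ⊗ I ⊗ I`. -/
def yeeAlong {N : ℕ} (C : Matrix (ZMod N) (ZMod N) ℂ) :
    Fin 3 → Matrix (YeeGrid N) (YeeGrid N) ℂ :=
  ![1 ⊗ₖ (1 ⊗ₖ C), 1 ⊗ₖ (C ⊗ₖ 1), C ⊗ₖ (1 ⊗ₖ 1)]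

/-- The discrete shifted partial derivative `∂ᵢ + i kᵢ`. -/
def yeeD (N : ℕ) (k : EuclideanSpace ℝ (Fin 3)) (i : Fin 3) :
    Matrix (YeeGrid N) (YeeGrid N) ℂ :=
  yeeAlong (yeeDiff N) i + (Complex.I * (k i : ℂ)) • yeeAlong (yeeAvg N) i

/-- The `3 × 3` array of blocks of the discrete shifted curl. -/
def yeeCurlBlocks (N : ℕ) (k : EuclideanSpace ℝ (Fin 3)) :
    Matrix (Fin 3) (Fin 3) (Matrix (YeeGrid N) (YeeGrid N) ℂ) :=
  !![0, -yeeD N k 2, yeeD N k 1;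
     yeeD N k 2, 0, -yeeD N k 0;
     -yeeD N k 1, yeeD N k 0, 0]

/-- The discrete shifted curl `𝒜`, from edge fields to face fields. -/
def yeeCurl (N : ℕ) (k : EuclideanSpace ℝ (Fin 3)) : Matrix (YeeDof N) (YeeDof N) ℂ :=
  Matrix.of fun p q => yeeCurlBlocks N k p.1 q.1 p.2 q.2

/-- The discrete shifted divergence `ℬ = (D₁ D₂ D₃)`, from face fields to cell functions. -/
def yeeDiv (N : ℕ) (k : EuclideanSpace ℝ (Fin 3)) : Matrix (YeeGrid N) (YeeDof N) ℂ :=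
  Matrix.of fun x q => yeeD N k q.1 x q.2

/-- The common kernel `ℋ = ker 𝒜† ∩ ker ℬ`. -/
def yeeKernel (N : ℕ) [NeZero N] (k : EuclideanSpace ℝ (Fin 3)) :
    Submodule ℂ (YeeDof N → ℂ) :=
  LinearMap.ker (Matrix.toLin' (yeeCurl N k).conjTranspose) ⊓
    LinearMap.ker (Matrix.toLin' (yeeDiv N k))

/-- The constant field `oᵢ`: equal to `1` on the `i`-th component and `0` on the others. -/
def yeeConstField (N : ℕ) (i : Fin 3) : YeeDof N → ℂ :=
  fun q => if q.1 = i then 1 else 0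

/-- The discrete double curl operator `𝒜 M 𝒜†`. -/
def yeeCurlCurl (N : ℕ) [NeZero N] (k : EuclideanSpace ℝ (Fin 3))
    (M : Matrix (YeeDof N) (YeeDof N) ℂ) : Matrix (YeeDof N) (YeeDof N) ℂ :=
  yeeCurl N k * M * (yeeCurl N k).conjTranspose

/-- The kernel-compensated operator `𝒜 M 𝒜† + γ ℬ† ℬ`. -/
def yeeCompensated (N : ℕ) [NeZero N] (k : EuclideanSpace ℝ (Fin 3))
    (M : Matrix (YeeDof N) (YeeDof N) ℂ) (γ : ℝ) : Matrix (YeeDof N) (YeeDof N) ℂ :=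
  yeeCurlCurl N k M + (γ : ℂ) • ((yeeDiv N k).conjTranspose * yeeDiv N k)

theorem yeeCurlCurl_isHermitian (N : ℕ) [NeZero N] (k : EuclideanSpace ℝ (Fin 3))
    {M : Matrix (YeeDof N) (YeeDof N) ℂ} (hM : M.IsHermitian) :
    (yeeCurlCurl N k M).IsHermitian :=
  Matrix.isHermitian_mul_mul_conjTranspose _ hM

theorem yeeCompensated_isHermitian (N : ℕ) [NeZero N] (k : EuclideanSpace ℝ (Fin 3))
    {M : Matrix (YeeDof N) (YeeDof N) ℂ} (hM : M.IsHermitian) (γ : ℝ) :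
    (yeeCompensated N k M γ).IsHermitian := by
  refine (yeeCurlCurl_isHermitian N k hM).add ?_
  have h := Matrix.isHermitian_conjTranspose_mul_self (yeeDiv N k)
  unfold Matrix.IsHermitian at h ⊢
  rw [Matrix.conjTranspose_smul, h]
  simp

/-- The solution space, for the value `μ` of `ω²`, of the discrete problem
`𝒜 M 𝒜† H = μ H`, `ℬ H = 0`. -/
def yeeDivFreeEigenspace (N : ℕ) [NeZero N] (k : EuclideanSpace ℝ (Fin 3))
    (M : Matrix (YeeDof N) (YeeDof N) ℂ) (μ : ℝ) : Submodule ℂ (YeeDof N → ℂ) :=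
  Module.End.eigenspace (Matrix.toLin' (yeeCurlCurl N k M)) (μ : ℂ) ⊓
    LinearMap.ker (Matrix.toLin' (yeeDiv N k))

/-- The positive eigenvalues of a Hermitian matrix, listed in increasing order and repeated
according to multiplicity. -/
def posEigenvalues {n : Type*} [Fintype n] [DecidableEq n] {T : Matrix n n ℂ}
    (hT : T.IsHermitian) : List ℝ :=
  ((Finset.univ.val.map hT.eigenvalues).filter (fun x => 0 < x)).sort (· ≤ ·)

open Classical in
/-- The penalty coefficient: `max {1, lam}` if `k = 0`, and
`max {1, lam} · max {1, ‖k‖⁻²}` if `k ≠ 0`. -/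
def yeePenalty (k : EuclideanSpace ℝ (Fin 3)) (lam : ℝ) : ℝ :=
  if k = 0 then max 1 lam else max 1 lam * max 1 ((‖k‖ ^ 2)⁻¹)

end

/-! Every `yeeD` is a combination of the identity and one grid translation, so these matrices and
their adjoints all commute. Hence ℬ𝒜 = 0, and ℬℬ† is the scalar Laplacian L = ∑ Dᵢ†Dᵢ, whose
eigenvalues are read off on the characters of the grid. If (𝒜M𝒜† + γℬ†ℬ)H = μH, applying ℬ gives
γL(ℬH) = μℬH. So either ℬH = 0, and H is an eigenvector of 𝒜M𝒜†, or μ/γ is an eigenvalue of L. By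
`yeeLaplacian_eigenvalue` the latter are ‖k‖² or at least 1, and γ is chosen so that μ > 0 then
forces μ ≥ λₘ. Thus the two operators have the same eigenspaces for 0 < μ < λₘ, while at λₘ the
penalty can only add eigenvectors; `List.take_eq_take_of_count` turns this into equality of the
first m eigenvalues. For ℋ, each component of a field in it is killed by L: zero if L is injective,
constant if k = 0. -/

/-- Two increasing lists whose counts agree below `l₁[m - 1]`, the second one having at least as
many copies of `l₁[m - 1]`, have the same first `m` entries. -/
theorem List.take_eq_take_of_count {α : Type*} [LinearOrder α] {l₁ l₂ : List α}
    (h₁ : l₁.Pairwise (· ≤ ·)) (h₂ : l₂.Pairwise (· ≤ ·)) {m : ℕ} (hm : m - 1 < l₁.length)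
    (hlt : ∀ x < l₁[m - 1], l₂.count x = l₁.count x)
    (hle : ∀ x ≤ l₁[m - 1], l₁.count x ≤ l₂.count x) :
    l₂.take m = l₁.take m := by
  induction l₁ generalizing l₂ m with
  | nil => simp at hm
  | cons a t₁ ih =>
    rcases Nat.eq_zero_or_pos m with rfl | hm0
    · simp
    have ha : a ≤ (a :: t₁)[m - 1] := by
      rcases List.mem_cons.1 (List.getElem_mem hm) with h | h
      · exact h.ge
      · exact (List.pairwise_cons.1 h₁).1 _ h
    have hal₂ : a ∈ l₂ := by
      rw [← List.count_pos_iff]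
      exact lt_of_lt_of_le (by simp) (hle a ha)
    cases l₂ with
    | nil => simp at hal₂
    | cons b t₂ =>
      have hba : b ≤ a := by
        rcases List.mem_cons.1 hal₂ with h | h
        · exact h.ge
        · exact (List.pairwise_cons.1 h₂).1 _ h
      have hab : a ≤ b := by
        by_contra! h
        have hb : b ∈ a :: t₁ := by
          rw [← List.count_pos_iff, ← hlt b (h.trans_le ha)]
          simp
        rcases List.mem_cons.1 hb with h' | h'
        · exact h.ne h'
        · exact ((List.pairwise_cons.1 h₁).1 _ h').not_gt h
      obtain rfl : b = a := le_antisymm hba hab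
      obtain ⟨m, rfl⟩ : ∃ n, m = n + 1 := ⟨m - 1, by omega⟩
      -- When only the head is taken, the induction hypothesis would refer to the first entry of a
      -- possibly empty tail.
      rcases Nat.eq_zero_or_pos m with rfl | hm1
      · simp
      obtain ⟨m, rfl⟩ : ∃ n, m = n + 1 := ⟨m - 1, by omega⟩
      simp only [List.take_succ_cons (i := m + 1), List.cons.injEq, true_and]
      refine ih (List.pairwise_cons.1 h₁).2 (List.pairwise_cons.1 h₂).2
        (m := m + 1) (by simpa using hm) (fun x hx => ?_) (fun x hx => ?_)
      · have := hlt x (by simpa using hx)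
        simpa [List.count_cons] using this
      · have := hle x (by simpa using hx)
        simpa [List.count_cons] using this

/-! ### Multiplicities as eigenspace dimensions -/

section Eigenvalues

variable {n : Type*} [Fintype n] [DecidableEq n] {T : Matrix n n ℂ}

theorem Matrix.IsHermitian.card_filter_eigenvalues_eq (hT : T.IsHermitian) (μ : ℝ) :
    Finset.card {i | hT.eigenvalues i = μ} =
      Module.finrank ℂ (Module.End.eigenspace (Matrix.toLin' T) (μ : ℂ)) := by
  have h := (Matrix.isSymmetric_toEuclideanLin_iff.mpr hT).card_filter_eigenvalues_eq
    finrank_euclideanSpace (μ : ℂ)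
  have h' : Finset.card {i | hT.eigenvalues i = μ} = Finset.card {i | hT.eigenvalues₀ i = μ} :=
    Finset.card_equiv (Fintype.equivOfCardEq (Fintype.card_fin _)).symm
      (fun i => by
        rw [Finset.mem_filter_univ, Finset.mem_filter_univ, Matrix.IsHermitian.eigenvalues])
  rw [h']
  refine Eq.trans (congrArg Finset.card (Finset.ext fun i => ?_)) (h.trans ?_)
  · rw [Finset.mem_filter_univ, Finset.mem_filter_univ]
    exact Complex.ofReal_inj.symm
  · refine LinearEquiv.finrank_eq (LinearEquiv.ofSubmodules (WithLp.linearEquiv 2 ℂ (n → ℂ)) _ _ ?_)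
    ext v
    rw [Submodule.mem_map_equiv, Module.End.mem_eigenspace_iff, Module.End.mem_eigenspace_iff,
      ← (WithLp.linearEquiv 2 ℂ (n → ℂ)).injective.eq_iff]
    rfl

theorem posEigenvalues_pairwise (hT : T.IsHermitian) : (posEigenvalues hT).Pairwise (· ≤ ·) :=
  Multiset.pairwise_sort _ _

theorem pos_of_mem_posEigenvalues (hT : T.IsHermitian) {x : ℝ} (hx : x ∈ posEigenvalues hT) :
    0 < x := by
  rw [posEigenvalues, Multiset.mem_sort, Multiset.mem_filter] at hx
  exact hx.2

theorem count_posEigenvalues_of_pos (hT : T.IsHermitian) {μ : ℝ} (hμ : 0 < μ) :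
    (posEigenvalues hT).count μ =
      Module.finrank ℂ (Module.End.eigenspace (Matrix.toLin' T) (μ : ℂ)) := by
  rw [← hT.card_filter_eigenvalues_eq, ← Multiset.coe_count, posEigenvalues, Multiset.sort_eq,
    Multiset.count_filter_of_pos hμ, Multiset.count_map, Finset.card_def]
  congr 1
  simp [Finset.filter, eq_comm]

theorem count_posEigenvalues_of_nonpos (hT : T.IsHermitian) {μ : ℝ} (hμ : μ ≤ 0) :
    (posEigenvalues hT).count μ = 0 :=
  List.count_eq_zero.2 fun h => (pos_of_mem_posEigenvalues hT h).not_ge hμ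

end Eigenvalues

/-! ### Lower bound for the one-dimensional symbol -/

/-- The chord from 1 to exp(2πi·j/N) has length 2 sin(πj/N), which for 0 < j < N is least at the two
neighbours of 1. Reflecting j to N − j brings the angle into [0, π/2], where sine increases. -/
theorem two_mul_sin_le_norm_sub_one_of_pow_eq_one {N : ℕ} [NeZero N] {ζ : ℂ} (hζ : ζ ^ N = 1)
    (h1 : ζ ≠ 1) : 2 * Real.sin (Real.pi / N) ≤ ‖ζ - 1‖ := by
  have hN : (0 : ℝ) < N := Nat.cast_pos.2 (NeZero.pos N)
  obtain ⟨i, hi, rfl⟩ :=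
    (Complex.isPrimitiveRoot_exp N (NeZero.ne N)).eq_pow_of_pow_eq_one hζ
  have hi0 : i ≠ 0 := by rintro rfl; simp at h1
  have hi1 : (1 : ℝ) ≤ i := by exact_mod_cast Nat.one_le_iff_ne_zero.2 hi0
  have hiN : (i : ℝ) + 1 ≤ N := by exact_mod_cast hi
  have e : Complex.exp (2 * Real.pi * Complex.I / N) ^ i =
      Complex.exp (Complex.I * ((2 * (Real.pi * i / N) : ℝ) : ℂ)) := by
    rw [← Complex.exp_nat_mul]
    push_cast
    congr 1
    ring
  rw [e, Complex.norm_exp_I_mul_ofReal_sub_one, mul_div_cancel_left₀ _ two_ne_zero, norm_mul,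
    Real.norm_ofNat]
  refine mul_le_mul_of_nonneg_left (le_trans ?_ (le_abs_self _)) zero_le_two
  have hpi := Real.pi_pos
  have hp : 0 < Real.pi / N := by positivity
  rcases le_total (2 * (i : ℝ)) N with h | h
  · refine Real.sin_le_sin_of_le_of_le_pi_div_two (by linarith) ?_ (by gcongr; nlinarith)
    rw [div_le_div_iff₀ hN two_pos]
    nlinarith
  · rw [← Real.sin_pi_sub (Real.pi * i / N)]
    have e2 : Real.pi - Real.pi * i / N = Real.pi * (N - i) / N := by field_simp
    rw [e2]
    refine Real.sin_le_sin_of_le_of_le_pi_div_two (by linarith) ?_ (by gcongr; nlinarith)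
    rw [div_le_div_iff₀ hN two_pos]
    nlinarith

/-- Away from `ζ = 1` the symbol of `∂ + i κ` on the `N`-th roots of unity has modulus at
least one. -/
theorem one_le_norm_symbol {N : ℕ} [NeZero N] {κ : ℝ}
    (hκ : κ = 0 ∨ |κ| ≤ Real.pi ∧ Real.pi < N) {ζ : ℂ} (hζ : ζ ^ N = 1) (h1 : ζ ≠ 1) :
    1 ≤ ‖(N + Complex.I * κ / 2) + (-N + Complex.I * κ / 2) * ζ‖ := by
  have hN : (0 : ℝ) < N := Nat.cast_pos.2 (NeZero.pos N)
  have hnorm : ‖ζ‖ = 1 := Complex.norm_eq_one_of_pow_eq_one hζ (NeZero.ne N)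
  have hs := two_mul_sin_le_norm_sub_one_of_pow_eq_one hζ h1
  have hN2 : (2 : ℝ) ≤ N := by
    have : 2 ≤ N := by
      by_contra! h
      obtain rfl : N = 1 := by have := NeZero.pos N; omega
      simp at hζ
      exact h1 hζ
    exact_mod_cast this
  have e : (N + Complex.I * κ / 2) + (-N + Complex.I * κ / 2) * ζ =
      -(N * (ζ - 1)) + Complex.I * κ / 2 * (1 + ζ) := by ring
  have hA : ‖(N : ℂ) * (ζ - 1)‖ - |κ| ≤ ‖(N + Complex.I * κ / 2) + (-N + Complex.I * κ / 2) * ζ‖ := by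
    have h2 : ‖Complex.I * κ / 2 * (1 + ζ)‖ ≤ |κ| := by
      have : ‖1 + ζ‖ ≤ 2 := (norm_add_le _ _).trans (by rw [hnorm, norm_one]; norm_num)
      rw [norm_mul, norm_div, norm_mul, Complex.norm_I, Complex.norm_real, Real.norm_eq_abs]
      simp only [one_mul, RCLike.norm_ofNat]
      nlinarith [abs_nonneg κ]
    rw [e]
    have := norm_sub_le_norm_add (-((N : ℂ) * (ζ - 1))) (Complex.I * κ / 2 * (1 + ζ))
    rw [norm_neg] at this
    linarith
  rw [norm_mul, Complex.norm_natCast] at hA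
  have hpi := Real.pi_pos
  have hpi3 := Real.pi_gt_three
  have hpi4 := Real.pi_lt_d2
  have hB : N * (2 * Real.sin (Real.pi / N)) ≤ N * ‖ζ - 1‖ := by gcongr
  rcases hκ with rfl | ⟨hκ, hNpi⟩
  -- Jordan's inequality sin x ≥ 2x/π gives N · 2 sin(π/N) ≥ 4.
  · have h3 := Real.mul_le_sin (x := Real.pi / N) (by positivity) (by gcongr)
    rw [div_mul_div_cancel₀ hpi.ne', div_le_iff₀ hN] at h3
    rw [abs_zero] at hA
    linarith
  · have hN4 : (4 : ℝ) ≤ N := by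
      have : 4 ≤ N := by
        by_contra! h
        have : (N : ℝ) ≤ 3 := by exact_mod_cast Nat.lt_succ_iff.1 h
        linarith
      exact_mod_cast this
    -- From sin x > x − x³/6, the difference term exceeds 2π − π³/(3N²) ≥ 2π − 1 for N ≥ 4; after
    -- losing |κ| ≤ π to the averaging term, at least π − 1 > 1 remains.
    have h3 := Real.sin_gt_sub_cube (x := Real.pi / N) (by positivity)
    have h4 : N * (2 * (Real.pi / N - (Real.pi / N) ^ 3 / 6)) =
        2 * Real.pi - Real.pi ^ 3 / (3 * N ^ 2) := by field_simp; ring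
    have h5 : Real.pi ^ 3 / (3 * (N : ℝ) ^ 2) ≤ 1 := by
      rw [div_le_one (by positivity)]
      have : Real.pi ^ 3 ≤ 3.15 ^ 3 := by gcongr
      nlinarith
    have h6 : N * (2 * (Real.pi / N - (Real.pi / N) ^ 3 / 6)) ≤
        N * (2 * Real.sin (Real.pi / N)) := by gcongr
    linarith

/-! ### Translations and characters of a finite abelian group -/

section Shift

variable {G : Type*} [AddCommGroup G] [DecidableEq G]

/-- The matrix of the translation `u ↦ u (· - g)`. -/
def shiftMatrix (g : G) : Matrix G G ℂ :=
  Matrix.of fun x y => if y = x - g then 1 else 0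

theorem shiftMatrix_conjTranspose (g : G) :
    (shiftMatrix g).conjTranspose = shiftMatrix (-g) := by
  ext x y
  have : x = y - g ↔ y = x + g := by rw [eq_sub_iff_add_eq, eq_comm]
  simp [shiftMatrix, Matrix.conjTranspose_apply, apply_ite, this]

variable [Fintype G]

theorem shiftMatrix_mulVec (g : G) (u : G → ℂ) (x : G) :
    Matrix.mulVec (shiftMatrix g) u x = u (x - g) := by
  simp [shiftMatrix, Matrix.mulVec, dotProduct]

theorem shiftMatrix_mul (g h : G) : shiftMatrix g * shiftMatrix h = shiftMatrix (g + h) := by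
  ext x y
  have h1 (z : G) : y = z - h ↔ z = y + h := by rw [eq_sub_iff_add_eq, eq_comm]
  have h2 : y + h = x - g ↔ y = x - (g + h) := by
    rw [← eq_sub_iff_add_eq, sub_sub]
  simp [shiftMatrix, Matrix.mul_apply, h1, h2]

theorem commute_shiftMatrix (g h : G) : Commute (shiftMatrix g) (shiftMatrix h) := by
  rw [Commute, SemiconjBy, shiftMatrix_mul, shiftMatrix_mul, add_comm]

theorem addChar_vecMul_shiftMatrix (χ : AddChar G ℂ) (g : G) :
    Matrix.vecMul χ (shiftMatrix g) = χ g • (χ : G → ℂ) := by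
  ext y
  have h (x : G) : y = x - g ↔ x = y + g := by rw [eq_sub_iff_add_eq, eq_comm]
  simp [shiftMatrix, Matrix.vecMul, dotProduct, h, AddChar.map_add_eq_mul, mul_comm]

/-- The characters form a basis of the functions on G, so a vector whose pairings with all of them
vanish is zero. -/
theorem exists_addChar_dotProduct_ne_zero {u : G → ℂ} (hu : u ≠ 0) :
    ∃ χ : AddChar G ℂ, (χ : G → ℂ) ⬝ᵥ u ≠ 0 := by
  by_contra! h
  refine hu (dotProduct_eq_zero u fun w => ?_)
  have h0 : (Matrix.toLin' (Matrix.replicateRow Unit u)) = 0 := by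
    refine (AddChar.complexBasis G).ext fun χ => ?_
    ext
    simpa [Matrix.mulVec, dotProduct_comm] using h χ
  have := congrFun (LinearMap.congr_fun h0 w) ()
  simpa [Matrix.mulVec] using this

end Shift

/-! ### Commutation relations and the spectrum of the Laplacian -/

section Yee

variable {N : ℕ} (k : EuclideanSpace ℝ (Fin 3))

/-- The unit grid steps in the directions `x`, `y`, `z`. -/
def yeeStep (N : ℕ) : Fin 3 → YeeGrid N :=
  ![(0, 0, 1), (0, 1, 0), (1, 0, 0)]

theorem yeeD_eq (i : Fin 3) :
    yeeD N k i = ((N : ℂ) + Complex.I * k i / 2) • 1 +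
      (-(N : ℂ) + Complex.I * k i / 2) • shiftMatrix (yeeStep N i) := by
  fin_cases i <;> ext ⟨x, y, z⟩ ⟨x', y', z'⟩ <;>
    simp only [yeeD, yeeAlong, yeeDiff, yeeAvg, yeeGridSize, yeeStep, shiftMatrix,
      Matrix.add_apply, Matrix.smul_apply, Matrix.kroneckerMap_apply, Matrix.one_apply,
      Matrix.of_apply, Prod.mk.injEq, Prod.mk_sub_mk, sub_zero, smul_eq_mul, Fin.zero_eta,
      Fin.mk_one, Fin.reduceFinMk, Matrix.cons_val_zero, Matrix.cons_val_one, Matrix.cons_val,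
      one_div, inv_inv, Complex.ofReal_natCast, @eq_comm _ x' x, @eq_comm _ y' y,
      @eq_comm _ z' z]
  · by_cases hx : x = x' <;> by_cases hy : y = y' <;> simp [hx, hy]
    split_ifs <;> ring
  · by_cases hx : x = x' <;> by_cases hz : z = z' <;> simp [hx, hz]
    split_ifs <;> ring
  · by_cases hy : y = y' <;> by_cases hz : z = z' <;> simp [hy, hz]
    split_ifs <;> ring

theorem yeeD_conjTranspose_eq (i : Fin 3) :
    (yeeD N k i).conjTranspose = star ((N : ℂ) + Complex.I * k i / 2) • 1 +
      star (-(N : ℂ) + Complex.I * k i / 2) • shiftMatrix (-yeeStep N i) := by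
  rw [yeeD_eq, Matrix.conjTranspose_add, Matrix.conjTranspose_smul, Matrix.conjTranspose_smul,
    shiftMatrix_conjTranspose, Matrix.conjTranspose_one]

variable [NeZero N]

theorem commute_one_add_shiftMatrix {G : Type*} [AddCommGroup G] [Fintype G] [DecidableEq G]
    (a b c d : ℂ) (g h : G) :
    Commute (a • 1 + b • shiftMatrix g) (c • 1 + d • shiftMatrix h) :=
  have h1 (X : Matrix G G ℂ) : Commute (a • 1) X := (Commute.one_left X).smul_left a
  have h2 (X : Matrix G G ℂ) : Commute X (c • 1) := (Commute.one_right X).smul_right c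
  ((h1 _).add_left ((h2 _).add_right
    (((commute_shiftMatrix g h).smul_left b).smul_right d)))

theorem commute_yeeD (i j : Fin 3) : Commute (yeeD N k i) (yeeD N k j) := by
  rw [yeeD_eq, yeeD_eq]
  exact commute_one_add_shiftMatrix _ _ _ _ _ _

theorem commute_yeeD_conjTranspose (i j : Fin 3) :
    Commute (yeeD N k i) (yeeD N k j).conjTranspose := by
  rw [yeeD_conjTranspose_eq, yeeD_eq]
  exact commute_one_add_shiftMatrix _ _ _ _ _ _

/-- The discrete shifted Laplacian (with the sign making it positive). -/
noncomputable def yeeLaplacian (N : ℕ) [NeZero N] (k : EuclideanSpace ℝ (Fin 3)) :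
    Matrix (YeeGrid N) (YeeGrid N) ℂ :=
  ∑ i, (yeeD N k i).conjTranspose * yeeD N k i

/-- The eigenvalue of `yeeD N k i` at the character `χ`, acting from the left. -/
noncomputable def yeeSymbol (k : EuclideanSpace ℝ (Fin 3)) (χ : AddChar (YeeGrid N) ℂ) (i : Fin 3) : ℂ :=
  (N + Complex.I * k i / 2) + (-N + Complex.I * k i / 2) * χ (yeeStep N i)

theorem addChar_vecMul_yeeD (χ : AddChar (YeeGrid N) ℂ) (i : Fin 3) :
    Matrix.vecMul χ (yeeD N k i) = yeeSymbol k χ i • (χ : YeeGrid N → ℂ) := by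
  rw [yeeD_eq, Matrix.vecMul_add, Matrix.vecMul_smul, Matrix.vecMul_smul, Matrix.vecMul_one,
    addChar_vecMul_shiftMatrix, yeeSymbol, smul_smul, ← add_smul]

theorem addChar_vecMul_yeeD_conjTranspose (χ : AddChar (YeeGrid N) ℂ) (i : Fin 3) :
    Matrix.vecMul χ (yeeD N k i).conjTranspose =
      star (yeeSymbol k χ i) • (χ : YeeGrid N → ℂ) := by
  rw [yeeD_conjTranspose_eq, Matrix.vecMul_add, Matrix.vecMul_smul, Matrix.vecMul_smul,
    Matrix.vecMul_one, addChar_vecMul_shiftMatrix, smul_smul, ← add_smul, AddChar.map_neg_eq_conj,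
    yeeSymbol, star_add (_ + _), star_mul']
  rfl

theorem addChar_vecMul_yeeLaplacian (χ : AddChar (YeeGrid N) ℂ) :
    Matrix.vecMul χ (yeeLaplacian N k) =
      ((∑ i, ‖yeeSymbol k χ i‖ ^ 2 : ℝ) : ℂ) • (χ : YeeGrid N → ℂ) := by
  rw [yeeLaplacian, Matrix.vecMul_sum, Complex.ofReal_sum, Finset.sum_smul]
  refine Finset.sum_congr rfl fun i _ => ?_
  rw [← Matrix.vecMul_vecMul, addChar_vecMul_yeeD_conjTranspose, Matrix.smul_vecMul,
    addChar_vecMul_yeeD, smul_smul]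
  congr 1
  rw [Complex.ofReal_pow, ← Complex.conj_mul']
  rfl

theorem addChar_yeeStep_pow {N : ℕ} (χ : AddChar (YeeGrid N) ℂ) (i : Fin 3) :
    χ (yeeStep N i) ^ N = 1 := by
  have : N • yeeStep N i = 0 := by fin_cases i <;> simp [yeeStep]
  rw [← AddChar.map_nsmul_eq_pow, this, AddChar.map_zero_eq_one]

/-- An eigenvalue of the shifted Laplacian is `‖k‖ ^ 2` or at least one. -/
theorem yeeLaplacian_eigenvalue {k : EuclideanSpace ℝ (Fin 3)}
    (hk : k ≠ 0 → (∀ i, |k i| ≤ Real.pi) ∧ yeeGridSize N < 1 / Real.pi)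
    {u : YeeGrid N → ℂ} (hu : u ≠ 0) {μ : ℝ}
    (h : Matrix.mulVec (yeeLaplacian N k) u = (μ : ℂ) • u) : μ = ‖k‖ ^ 2 ∨ 1 ≤ μ := by
  have hκ (i : Fin 3) : k i = 0 ∨ |k i| ≤ Real.pi ∧ Real.pi < N := by
    by_cases h0 : k = 0
    · simp [h0]
    · refine .inr ⟨(hk h0).1 i, ?_⟩
      exact (one_div_lt_one_div (Nat.cast_pos.2 (NeZero.pos N)) Real.pi_pos).1 (hk h0).2
  obtain ⟨χ, hχ⟩ := exists_addChar_dotProduct_ne_zero hu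
  -- The character is a left eigenvector of the Laplacian and pairs nontrivially with `u`, so the
  -- two eigenvalues agree.
  have hμ : μ = ∑ i, ‖yeeSymbol k χ i‖ ^ 2 := by
    have h1 := Matrix.dotProduct_mulVec (χ : YeeGrid N → ℂ) (yeeLaplacian N k) u
    rw [h, addChar_vecMul_yeeLaplacian, dotProduct_smul, smul_dotProduct] at h1
    exact Complex.ofReal_injective (mul_right_cancel₀ hχ h1)
  by_cases h1 : ∀ i, χ (yeeStep N i) = 1
  · left
    rw [hμ, EuclideanSpace.real_norm_sq_eq]
    refine Finset.sum_congr rfl fun i _ => ?_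
    have : yeeSymbol k χ i = Complex.I * k i := by rw [yeeSymbol, h1]; ring
    rw [this, norm_mul, Complex.norm_I, one_mul, Complex.norm_real, Real.norm_eq_abs, sq_abs]
  · right
    push Not at h1
    obtain ⟨i, hi⟩ := h1
    have h2 : 1 ≤ ‖yeeSymbol k χ i‖ :=
      one_le_norm_symbol (hκ i) (addChar_yeeStep_pow χ i) hi
    rw [hμ]
    exact (one_le_pow₀ h2).trans
      (Finset.single_le_sum (f := fun i => ‖yeeSymbol k χ i‖ ^ 2) (fun _ _ => by positivity)
        (Finset.mem_univ i))

end Yee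

/-! ### The common kernel -/

section Kernel

variable {N : ℕ} [NeZero N] (k : EuclideanSpace ℝ (Fin 3))

theorem yeeDiv_mulVec (H : YeeDof N → ℂ) :
    Matrix.mulVec (yeeDiv N k) H = ∑ i, Matrix.mulVec (yeeD N k i) fun x => H (i, x) := by
  ext x
  simp [Matrix.mulVec, dotProduct, yeeDiv, Fintype.sum_prod_type, Finset.sum_apply]

theorem yeeCurl_conjTranspose_mulVec (H : YeeDof N → ℂ) (i : Fin 3) (x : YeeGrid N) :
    Matrix.mulVec (yeeCurl N k).conjTranspose H (i, x) =
      ∑ j, Matrix.mulVec (yeeCurlBlocks N k j i).conjTranspose (fun y => H (j, y)) x := by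
  simp [Matrix.mulVec, dotProduct, yeeCurl, Fintype.sum_prod_type]

theorem yeeDiv_mul_yeeCurl : yeeDiv N k * yeeCurl N k = 0 := by
  ext x ⟨c, y⟩
  have h : (yeeDiv N k * yeeCurl N k) x (c, y) =
      (∑ i, yeeD N k i * yeeCurlBlocks N k i c) x y := by
    simp [Matrix.mul_apply, Matrix.sum_apply, yeeDiv, yeeCurl, Fintype.sum_prod_type]
  rw [h]
  have h01 := (commute_yeeD (N := N) k 0 1).eq
  have h02 := (commute_yeeD (N := N) k 0 2).eq
  have h12 := (commute_yeeD (N := N) k 1 2).eq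
  fin_cases c <;> simp [Fin.sum_univ_three, yeeCurlBlocks, h01, h02, h12]

theorem yeeDiv_mul_conjTranspose :
    yeeDiv N k * (yeeDiv N k).conjTranspose = yeeLaplacian N k := by
  ext x y
  rw [yeeLaplacian]
  simp_rw [← (commute_yeeD_conjTranspose k _ _).eq]
  simp [Matrix.mul_apply, Matrix.sum_apply, yeeDiv, Fintype.sum_prod_type]

theorem mem_yeeKernel_iff {H : YeeDof N → ℂ} :
    H ∈ yeeKernel N k ↔
      (∀ i j, Matrix.mulVec (yeeD N k i).conjTranspose (fun x => H (j, x)) =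
        Matrix.mulVec (yeeD N k j).conjTranspose fun x => H (i, x)) ∧
      ∑ i, Matrix.mulVec (yeeD N k i) (fun x => H (i, x)) = 0 := by
  rw [yeeKernel, Submodule.mem_inf, LinearMap.mem_ker, LinearMap.mem_ker, Matrix.toLin'_apply,
    Matrix.toLin'_apply, yeeDiv_mulVec]
  refine and_congr_left fun _ => ?_
  have e : Matrix.mulVec (yeeCurl N k).conjTranspose H = 0 ↔ ∀ i x,
      ∑ j, Matrix.mulVec (yeeCurlBlocks N k j i).conjTranspose (fun y => H (j, y)) x = 0 := by
    simp_rw [← yeeCurl_conjTranspose_mulVec]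
    exact ⟨fun h i x => congrFun h (i, x), fun h => funext fun p => h p.1 p.2⟩
  simp only [e, Fin.forall_fin_succ, Fin.sum_univ_three, yeeCurlBlocks, funext_iff]
  simp [Matrix.neg_mulVec, ← sub_eq_add_neg, ← forall_and, neg_add_eq_sub]
  simp only [sub_eq_zero]
  exact forall₃_congr fun _ _ _ => by grind

/-- By commutation and Dᵢ†Hⱼ = Dⱼ†Hᵢ, one has Dᵢ†DᵢHⱼ = DᵢDⱼ†Hᵢ = Dⱼ†DᵢHᵢ; summing over i gives
Dⱼ†ℬH = 0. -/
theorem yeeLaplacian_mulVec_of_mem_yeeKernel {H : YeeDof N → ℂ} (hH : H ∈ yeeKernel N k)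
    (j : Fin 3) : Matrix.mulVec (yeeLaplacian N k) (fun x => H (j, x)) = 0 := by
  obtain ⟨h1, h2⟩ := (mem_yeeKernel_iff k).1 hH
  have h3 (i : Fin 3) : Matrix.mulVec ((yeeD N k i).conjTranspose * yeeD N k i)
      (fun x => H (j, x)) =
      Matrix.mulVec (yeeD N k j).conjTranspose
        (Matrix.mulVec (yeeD N k i) fun x => H (i, x)) := by
    rw [← (commute_yeeD_conjTranspose k i i).eq, ← Matrix.mulVec_mulVec, h1,
      Matrix.mulVec_mulVec, Matrix.mulVec_mulVec, (commute_yeeD_conjTranspose k i j).eq]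
  rw [yeeLaplacian, Matrix.sum_mulVec]
  simp_rw [h3]
  rw [← Matrix.mulVec_sum, h2, Matrix.mulVec_zero]

/-- The quadratic form of the Laplacian at u is ∑ ‖Dᵢu‖². -/
theorem yeeD_mulVec_eq_zero_of_yeeLaplacian {u : YeeGrid N → ℂ}
    (hu : Matrix.mulVec (yeeLaplacian N k) u = 0) (i : Fin 3) :
    Matrix.mulVec (yeeD N k i) u = 0 := by
  have h : ∑ i, star (Matrix.mulVec (yeeD N k i) u) ⬝ᵥ Matrix.mulVec (yeeD N k i) u = 0 := by
    have h1 : star u ⬝ᵥ Matrix.mulVec (yeeLaplacian N k) u = 0 := by rw [hu, dotProduct_zero]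
    rw [yeeLaplacian, Matrix.sum_mulVec, dotProduct_sum] at h1
    rw [← h1]
    refine Finset.sum_congr rfl fun i _ => ?_
    rw [Matrix.star_mulVec, ← Matrix.dotProduct_mulVec, Matrix.mulVec_mulVec]
  rw [Finset.sum_eq_zero_iff_of_nonneg fun _ _ => dotProduct_star_self_nonneg _] at h
  exact dotProduct_star_self_eq_zero.1 (h i (Finset.mem_univ i))

theorem yeeD_zero_mulVec (i : Fin 3) (u : YeeGrid N → ℂ) (x : YeeGrid N) :
    Matrix.mulVec (yeeD N 0 i) u x = N * (u x - u (x - yeeStep N i)) := by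
  rw [yeeD_eq, Matrix.add_mulVec, Matrix.smul_mulVec, Matrix.smul_mulVec, Matrix.one_mulVec]
  simp [shiftMatrix_mulVec]
  ring

theorem eq_apply_zero_of_yeeStep_invariant {u : YeeGrid N → ℂ}
    (h : ∀ i x, u (x - yeeStep N i) = u x) (x : YeeGrid N) : u x = u 0 := by
  have h1 (i : Fin 3) (n : ℕ) (x : YeeGrid N) : u (x - n • yeeStep N i) = u x := by
    induction n with
    | zero => simp
    | succ n ih => rw [succ_nsmul, ← sub_sub, h, ih]
  have h2 : x - x.2.2.val • yeeStep N 0 - x.2.1.val • yeeStep N 1 - x.1.val • yeeStep N 2 =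
      0 := by
    obtain ⟨a, b, c⟩ := x
    simp [yeeStep]
  rw [← h2, h1, h1, h1]

theorem sum_smul_yeeConstField {N : ℕ} (c : Fin 3 → ℂ) (q : YeeDof N) :
    (∑ i, c i • yeeConstField N i) q = c q.1 := by
  simp [yeeConstField, Finset.sum_apply]

theorem linearIndependent_yeeConstField {N : ℕ} : LinearIndependent ℂ (yeeConstField N) := by
  rw [Fintype.linearIndependent_iff]
  intro c hc i
  have := congrFun hc (i, 0)
  rwa [sum_smul_yeeConstField] at this

theorem yeeKernel_zero : yeeKernel N 0 = Submodule.span ℂ (Set.range (yeeConstField N)) := by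
  have hN : (N : ℂ) ≠ 0 := Nat.cast_ne_zero.2 (NeZero.ne N)
  apply le_antisymm
  · intro H hH
    rw [Submodule.mem_span_range_iff_exists_fun]
    refine ⟨fun i => H (i, 0), funext fun ⟨i, x⟩ => ?_⟩
    rw [sum_smul_yeeConstField]
    refine (eq_apply_zero_of_yeeStep_invariant (u := fun x => H (i, x)) (fun j x => ?_) x).symm
    have h := congrFun (yeeD_mulVec_eq_zero_of_yeeLaplacian 0
      (yeeLaplacian_mulVec_of_mem_yeeKernel 0 hH i) j) x
    rw [yeeD_zero_mulVec] at h
    exact (sub_eq_zero.1 ((mul_eq_zero.1 h).resolve_left hN)).symm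
  · rw [Submodule.span_le]
    rintro _ ⟨i, rfl⟩
    have h0 (j l : Fin 3) :
        Matrix.mulVec (yeeD N 0 l) (fun x => yeeConstField N i (j, x)) = 0 := by
      ext x
      simp [yeeD_zero_mulVec, yeeConstField]
    have h0' (j l : Fin 3) :
        Matrix.mulVec (yeeD N 0 l).conjTranspose (fun x => yeeConstField N i (j, x)) = 0 := by
      ext x
      rw [yeeD_conjTranspose_eq, Matrix.add_mulVec, Matrix.smul_mulVec, Matrix.smul_mulVec,
        Matrix.one_mulVec]
      simp [shiftMatrix_mulVec, yeeConstField]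
    exact (mem_yeeKernel_iff 0).2 ⟨fun _ _ => by rw [h0', h0'], by simp [h0]⟩

theorem yeeKernel_eq_bot {k : EuclideanSpace ℝ (Fin 3)} (hk0 : k ≠ 0)
    (hk : ∀ i, |k i| ≤ Real.pi) (hN : yeeGridSize N < 1 / Real.pi) : yeeKernel N k = ⊥ := by
  rw [Submodule.eq_bot_iff]
  intro H hH
  ext ⟨i, x⟩
  suffices h : (fun x => H (i, x)) = 0 from congrFun h x
  by_contra hu
  have h := yeeLaplacian_eigenvalue (μ := 0) (fun _ => ⟨hk, hN⟩) hu
    (by simp [yeeLaplacian_mulVec_of_mem_yeeKernel k hH i])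
  have : 0 < ‖k‖ := norm_pos_iff.2 hk0
  rcases h with h | h
  · exact (pow_pos this 2).ne h
  · linarith

end Kernel

/-! ### Comparing the two operators' eigenspaces -/

section Spectrum

variable {N : ℕ} [NeZero N] (k : EuclideanSpace ℝ (Fin 3)) (M : Matrix (YeeDof N) (YeeDof N) ℂ)

theorem yeeDiv_mul_yeeCurlCurl : yeeDiv N k * yeeCurlCurl N k M = 0 := by
  rw [yeeCurlCurl, ← Matrix.mul_assoc, ← Matrix.mul_assoc, yeeDiv_mul_yeeCurl, Matrix.zero_mul,
    Matrix.zero_mul]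

theorem eigenspace_yeeCurlCurl_le_ker {μ : ℝ} (hμ : 0 < μ) :
    Module.End.eigenspace (Matrix.toLin' (yeeCurlCurl N k M)) (μ : ℂ) ≤
      LinearMap.ker (Matrix.toLin' (yeeDiv N k)) := by
  intro H hH
  rw [Module.End.mem_eigenspace_iff, Matrix.toLin'_apply] at hH
  have h := congrArg (Matrix.mulVec (yeeDiv N k)) hH
  rw [Matrix.mulVec_mulVec, yeeDiv_mul_yeeCurlCurl, Matrix.zero_mulVec, Matrix.mulVec_smul] at h
  rw [LinearMap.mem_ker, Matrix.toLin'_apply]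
  exact (smul_eq_zero.1 h.symm).resolve_left (Complex.ofReal_ne_zero.2 hμ.ne')

theorem yeeCompensated_mulVec_of_mem_ker (γ : ℝ) {H : YeeDof N → ℂ}
    (hH : Matrix.mulVec (yeeDiv N k) H = 0) :
    Matrix.mulVec (yeeCompensated N k M γ) H = Matrix.mulVec (yeeCurlCurl N k M) H := by
  rw [yeeCompensated, Matrix.add_mulVec, Matrix.smul_mulVec, ← Matrix.mulVec_mulVec, hH,
    Matrix.mulVec_zero, smul_zero, add_zero]

theorem eigenspace_yeeCurlCurl_le {μ : ℝ} (hμ : 0 < μ) (γ : ℝ) :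
    Module.End.eigenspace (Matrix.toLin' (yeeCurlCurl N k M)) (μ : ℂ) ≤
      Module.End.eigenspace (Matrix.toLin' (yeeCompensated N k M γ)) (μ : ℂ) := by
  intro H hH
  have h := eigenspace_yeeCurlCurl_le_ker k M hμ hH
  rw [LinearMap.mem_ker, Matrix.toLin'_apply] at h
  rw [Module.End.mem_eigenspace_iff, Matrix.toLin'_apply] at hH ⊢
  rw [yeeCompensated_mulVec_of_mem_ker k M γ h, hH]

theorem yeePenalty_pos (k : EuclideanSpace ℝ (Fin 3)) (lam : ℝ) : 0 < yeePenalty k lam := by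
  rw [yeePenalty]
  split_ifs <;> positivity

theorem eigenspace_yeeCompensated_le {k : EuclideanSpace ℝ (Fin 3)}
    (hk : k ≠ 0 → (∀ i, |k i| ≤ Real.pi) ∧ yeeGridSize N < 1 / Real.pi)
    {μ lam : ℝ} (hμ : 0 < μ) (hlam : μ < lam) :
    Module.End.eigenspace (Matrix.toLin' (yeeCompensated N k M (yeePenalty k lam))) (μ : ℂ) ≤
      Module.End.eigenspace (Matrix.toLin' (yeeCurlCurl N k M)) (μ : ℂ) := by
  intro H hH
  rw [Module.End.mem_eigenspace_iff, Matrix.toLin'_apply] at hH ⊢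
  have hγ := yeePenalty_pos k lam
  suffices h : Matrix.mulVec (yeeDiv N k) H = 0 by
    rw [← hH, yeeCompensated_mulVec_of_mem_ker k M _ h]
  by_contra hu
  have h := congrArg (Matrix.mulVec (yeeDiv N k)) hH
  rw [Matrix.mulVec_mulVec, yeeCompensated, Matrix.mul_add, yeeDiv_mul_yeeCurlCurl, zero_add,
    Matrix.mul_smul, ← Matrix.mul_assoc, yeeDiv_mul_conjTranspose, Matrix.smul_mulVec,
    ← Matrix.mulVec_mulVec, Matrix.mulVec_smul] at h
  have hE := yeeLaplacian_eigenvalue (μ := μ / yeePenalty k lam) hk hu (by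
    rw [Complex.ofReal_div, div_eq_inv_mul, mul_smul, ← h, smul_smul,
      inv_mul_cancel₀ (Complex.ofReal_ne_zero.2 hγ.ne'), one_smul])
  have hmax : lam ≤ max 1 lam := le_max_right _ _
  have h1 : 1 ≤ max 1 lam := le_max_left _ _
  by_cases h0 : k = 0
  · rw [yeePenalty, if_pos h0] at hE
    rcases hE with hE | hE
    -- For k = 0 the exceptional eigenvalue ‖k‖² is 0, which μ > 0 excludes.
    · rw [h0, norm_zero, zero_pow two_ne_zero] at hE
      exact (div_pos hμ (by linarith)).ne' hE
    · rw [one_le_div (by linarith)] at hE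
      linarith
  · have hk2 : 0 < ‖k‖ ^ 2 := pow_pos (norm_pos_iff.2 h0) 2
    rw [yeePenalty, if_neg h0] at hE hγ
    rcases hE with hE | hE
    · rw [div_eq_iff hγ.ne'] at hE
      -- The factor max{1, ‖k‖⁻²} compensates a small ‖k‖², so μ = γ‖k‖² ≥ max{1, lam}, against μ <
      -- lam.
      have h2 : 1 ≤ ‖k‖ ^ 2 * max 1 (‖k‖ ^ 2)⁻¹ := by
        rw [← mul_inv_cancel₀ hk2.ne']
        gcongr
        exact le_max_right _ _
      nlinarith
    · rw [one_le_div hγ] at hE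
      have h2 : 1 ≤ max 1 (‖k‖ ^ 2)⁻¹ := le_max_left _ _
      nlinarith

end Spectrum

theorem mainTheorem1 (N : ℕ) [NeZero N] (k : EuclideanSpace ℝ (Fin 3))
    (M : Matrix (YeeDof N) (YeeDof N) ℂ) (hM : M.PosDef) :
    -- the common kernel
    (k = 0 →
      yeeKernel N k = Submodule.span ℂ (Set.range (yeeConstField N)) ∧
      Module.finrank ℂ (yeeKernel N k) = 3) ∧
    (k ≠ 0 → (∀ i, |k i| ≤ Real.pi) → yeeGridSize N < 1 / Real.pi → yeeKernel N k = ⊥) ∧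
    -- the positive eigenvalues of the double curl operator, with multiplicity, are those of the
    -- discrete problem with the divergence constraint
    (∀ μ : ℝ, 0 < μ →
      (posEigenvalues (yeeCurlCurl_isHermitian N k hM.isHermitian)).count μ =
        Module.finrank ℂ (yeeDivFreeEigenspace N k M μ)) ∧
    -- the penalty: the first `m` positive eigenvalues coincide
    (∀ (m : ℕ) (_ : 1 ≤ m)
      (_ : m ≤ (posEigenvalues (yeeCurlCurl_isHermitian N k hM.isHermitian)).length),
      (k ≠ 0 → (∀ i, |k i| ≤ Real.pi) ∧ yeeGridSize N < 1 / Real.pi) →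
      (posEigenvalues (yeeCompensated_isHermitian N k hM.isHermitian
          (yeePenalty k
            ((posEigenvalues (yeeCurlCurl_isHermitian N k hM.isHermitian))[m - 1])))).take m =
        (posEigenvalues (yeeCurlCurl_isHermitian N k hM.isHermitian)).take m) := by
  refine ⟨?_, yeeKernel_eq_bot, fun μ hμ => ?_, fun m hm hm' hk => ?_⟩
  · rintro rfl
    refine ⟨yeeKernel_zero, ?_⟩
    rw [yeeKernel_zero, finrank_span_eq_card linearIndependent_yeeConstField, Fintype.card_fin]
  · rw [count_posEigenvalues_of_pos _ hμ, yeeDivFreeEigenspace,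
      inf_eq_left.2 (eigenspace_yeeCurlCurl_le_ker k M hμ)]
  · refine List.take_eq_take_of_count (posEigenvalues_pairwise _) (posEigenvalues_pairwise _)
      (by omega) (fun μ hlt => ?_) (fun μ _ => ?_)
    · rcases le_or_gt μ 0 with hμ | hμ
      · rw [count_posEigenvalues_of_nonpos _ hμ, count_posEigenvalues_of_nonpos _ hμ]
      · rw [count_posEigenvalues_of_pos _ hμ, count_posEigenvalues_of_pos _ hμ,
          le_antisymm (eigenspace_yeeCompensated_le M hk hμ hlt)
            (eigenspace_yeeCurlCurl_le k M hμ _)]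
    · rcases le_or_gt μ 0 with hμ | hμ
      · rw [count_posEigenvalues_of_nonpos _ hμ, count_posEigenvalues_of_nonpos _ hμ]
      · rw [count_posEigenvalues_of_pos _ hμ, count_posEigenvalues_of_pos _ hμ]
        exact Submodule.finrank_mono (eigenspace_yeeCurlCurl_le k M hμ _)
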